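/- Let $L, r, t \ge 1$ be integers, let $\sigma > 0$, and let $C^{(1)},\dots,C^{(L)} \in \mathbb{C}^{r\times r}$ and $\tilde C^{(1)},\dots,\tilde C^{(L)} \in \mathbb{C}^{t\times t}$ be Hermitian positive definite matrices. Write $|M|$ for the determinant of $M$, and let $\mathcal{C}_1$ be the set of Hermitian positive semidefinite $t\times t$ matrices $Q$ with $\frac1t\mathrm{Tr}(Q)=1$. For $\kappa,\tilde\kappa\in(0,\infty)^L$ and $Q\in\mathcal{C}_1$ put $$\tilde C(\kappa)=\sum_{l=1}^L\kappa_l\tilde C^{(l)},\quad T(\tilde\kappa)=\Big[\sigma^2\Big(I+\sum_{j=1}^L\tilde\kappa_jC^{(j)}\Big)\Big]^{-1},\quad \tilde T(\kappa,Q)=\Big[\sigma^2\Big(I+\sum_{j=1}^L\kappa_jQ^{1/2}\tilde C^{(j)}Q^{1/2}\Big)\Big]^{-1}.$$ The canonical system attached to $Q$ is the system of $2L$ equations $$\kappa_l=\frac1t\mathrm{Tr}\big[C^{(l)}T(\tilde\kappa)\big],\qquad \tilde\kappa_l=\frac1t\mathrm{Tr}\big[Q^{1/2}\tilde C^{(l)}Q^{1/2}\,\tilde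 T(\kappa,Q)\big],\qquad l=1,\dots,L.$$ For every $Q\in\mathcal{C}_1$ it has exactly one solution $(\kappa,\tilde\kappa)=(\delta(Q),\tilde\delta(Q))$ with all components positive. Let $$\overline I(Q)=\log\Big|I+\sum_{l=1}^L\tilde\delta_l(Q)C^{(l)}\Big|+\log\Big|I+Q\sum_{l=1}^L\delta_l(Q)\tilde C^{(l)}\Big|-\sigma^2t\sum_{l=1}^L\delta_l(Q)\tilde\delta_l(Q).$$ Then $\overline I$ has a unique maximizer $\overline Q_*$ over $\mathcal{C}_1$, and for every $\kappa\in(0,\infty)^L$ the waterfilling problem of maximizing $Q\mapsto\log|I+Q\tilde C(\kappa)|$ over $\mathcal{C}_1$ has a unique solution. Consider the iterative waterfilling algorithm: start from $Q_0\in\mathcal{C}_1$ (for instance $Q_0=I$); for $k\ge1$, let $(\delta^{(k)},\tilde\delta^{(k)})=(\delta(Q_{k-1}),\tilde\delta(Q_{k-1}))$ be the positive solution of the canonical system attached to $Q_{k-1}$, and let $Q_k$ be the maximizer of $Q\mapsto\log|I+Q\tilde C(\delta^{(k)})|$ over $\mathcal{C}_1$. If $$\lim_{k\to\infty}\big(\delta^{(k)}-\delta^{(k-1)}\big)=\lim_{k\to\infty}\big(\tilde\delta^{(k)}-\tilde\delta^{(k-1)}\big)=0,$$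 then $Q_k\to\overline Q_*$ as $k\to\infty$. -/

import Mathlib

open Filter Topology
open scoped Matrix ComplexOrder MatrixOrder

noncomputable section

namespace MIMO

variable {L r t : ℕ}

/-- The compact convex set of positive semidefinite Hermitian `t × t` matrices `Q` with
`(1 / t) Tr Q = 1`. -/
def C1 (t : ℕ) : Set (Matrix (Fin t) (Fin t) ℂ) :=
  {Q | Q.PosSemidef ∧ (1 / (t : ℂ)) * Q.trace = 1}

/-- The nonnegative square root `Q^{1/2}` of a positive semidefinite matrix. -/
def msqrt (Q : Matrix (Fin t) (Fin t) ℂ) : Matrix (Fin t) (Fin t) ℂ := CFC.sqrt Q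

/-- The linear combination `∑ l, κ_l M^{(l)}`; it is `C(κ̃)` for the receive correlation matrices
and `C̃(κ)` for the transmit correlation matrices. -/
def comb {n : ℕ} (M : Fin L → Matrix (Fin n) (Fin n) ℂ) (κ : Fin L → ℝ) :
    Matrix (Fin n) (Fin n) ℂ :=
  ∑ l, (κ l : ℂ) • M l

/-- `T(κ̃) = (σ² (I + ∑ j, κ̃_j C^{(j)}))⁻¹`. -/
def T (σ : ℝ) (C : Fin L → Matrix (Fin r) (Fin r) ℂ) (κt : Fin L → ℝ) :
    Matrix (Fin r) (Fin r) ℂ :=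
  (((σ ^ 2 : ℝ) : ℂ) • (1 + ∑ j, (κt j : ℂ) • C j))⁻¹

/-- `T̃(κ, Q) = (σ² (I + ∑ j, κ_j Q^{1/2} C̃^{(j)} Q^{1/2}))⁻¹`. -/
def Tt (σ : ℝ) (Ct : Fin L → Matrix (Fin t) (Fin t) ℂ) (κ : Fin L → ℝ)
    (Q : Matrix (Fin t) (Fin t) ℂ) : Matrix (Fin t) (Fin t) ℂ :=
  (((σ ^ 2 : ℝ) : ℂ) • (1 + ∑ j, (κ j : ℂ) • (msqrt Q * Ct j * msqrt Q)))⁻¹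

/-- `f_l(κ̃) = (1 / t) Tr [C^{(l)} T(κ̃)]`. The trace is that of a product of two Hermitian
matrices, hence real. -/
def f (t : ℕ) (σ : ℝ) (C : Fin L → Matrix (Fin r) (Fin r) ℂ) (l : Fin L) (κt : Fin L → ℝ) : ℝ :=
  (1 / (t : ℝ)) * (C l * T σ C κt).trace.re

/-- `f̃_l(κ, Q) = (1 / t) Tr [Q^{1/2} C̃^{(l)} Q^{1/2} T̃(κ, Q)]`. Again the trace is real. -/
def ft (σ : ℝ) (Ct : Fin L → Matrix (Fin t) (Fin t) ℂ) (l : Fin L) (κ : Fin L → ℝ)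
    (Q : Matrix (Fin t) (Fin t) ℂ) : ℝ :=
  (1 / (t : ℝ)) * (msqrt Q * Ct l * msqrt Q * Tt σ Ct κ Q).trace.re

/-- `(κ, κ̃)` is a positive solution of the canonical system of `2 L` equations
`κ_l = f_l(κ̃)`, `κ̃_l = f̃_l(κ, Q)`. -/
structure IsCanonicalSolution (σ : ℝ) (C : Fin L → Matrix (Fin r) (Fin r) ℂ)
    (Ct : Fin L → Matrix (Fin t) (Fin t) ℂ) (Q : Matrix (Fin t) (Fin t) ℂ)
    (κ κt : Fin L → ℝ) : Prop where
  pos : ∀ l, 0 < κ l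
  pos_tilde : ∀ l, 0 < κt l
  eq : ∀ l, κ l = f t σ C l κt
  eq_tilde : ∀ l, κt l = ft σ Ct l κ Q

open Classical in
/-- The pair `(δ(Q), δ̃(Q))`: the positive solution of the canonical system attached to `Q`
(with a dummy value if there were none). -/
def canonicalSolution (σ : ℝ) (C : Fin L → Matrix (Fin r) (Fin r) ℂ)
    (Ct : Fin L → Matrix (Fin t) (Fin t) ℂ) (Q : Matrix (Fin t) (Fin t) ℂ) :
    (Fin L → ℝ) × (Fin L → ℝ) :=
  if h : ∃ p : (Fin L → ℝ) × (Fin L → ℝ), IsCanonicalSolution σ C Ct Q p.1 p.2 then h.choose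
  else 0

/-- `δ(Q)`. -/
def delta (σ : ℝ) (C : Fin L → Matrix (Fin r) (Fin r) ℂ)
    (Ct : Fin L → Matrix (Fin t) (Fin t) ℂ) (Q : Matrix (Fin t) (Fin t) ℂ) : Fin L → ℝ :=
  (canonicalSolution σ C Ct Q).1

/-- `δ̃(Q)`. -/
def deltat (σ : ℝ) (C : Fin L → Matrix (Fin r) (Fin r) ℂ)
    (Ct : Fin L → Matrix (Fin t) (Fin t) ℂ) (Q : Matrix (Fin t) (Fin t) ℂ) : Fin L → ℝ :=
  (canonicalSolution σ C Ct Q).2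

/-- `log |M|`, for matrices `M` whose determinant is a positive real number. -/
def logDet {n : ℕ} (M : Matrix (Fin n) (Fin n) ℂ) : ℝ := Real.log M.det.re

/-- The large system approximation
`Ī(Q) = log |I + ∑ δ̃_l(Q) C^{(l)}| + log |I + Q ∑ δ_l(Q) C̃^{(l)}| - σ² t ∑ δ_l(Q) δ̃_l(Q)`. -/
def Ibar (σ : ℝ) (C : Fin L → Matrix (Fin r) (Fin r) ℂ)
    (Ct : Fin L → Matrix (Fin t) (Fin t) ℂ) (Q : Matrix (Fin t) (Fin t) ℂ) : ℝ :=
  logDet (1 + comb C (deltat σ C Ct Q)) + logDet (1 + Q * comb Ct (delta σ C Ct Q))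
    - σ ^ 2 * t * ∑ l, delta σ C Ct Q l * deltat σ C Ct Q l

/-- `P` solves the waterfilling problem attached to `κ`: it maximizes
`Q ↦ log |I + Q C̃(κ)|` over `C1`. -/
def IsWaterfillingSolution (Ct : Fin L → Matrix (Fin t) (Fin t) ℂ) (κ : Fin L → ℝ)
    (P : Matrix (Fin t) (Fin t) ℂ) : Prop :=
  P ∈ C1 t ∧ IsMaxOn (fun Q => logDet (1 + Q * comb Ct κ)) (C1 t) P

/-- `Q`, `δ`, `δ̃` are produced by the iterative waterfilling algorithm started at `Q₀`: for every
`k ≥ 1`, `(δ^{(k)}, δ̃^{(k)})` is the positive solution of the canonical system attached to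
`Q_{k-1}`, and `Q_k` maximizes `Q ↦ log |I + Q C̃(δ^{(k)})|` over `C1`.
(The values `δ 0`, `δt 0` are not used.) -/
structure IsIterativeWaterfilling (σ : ℝ) (C : Fin L → Matrix (Fin r) (Fin r) ℂ)
    (Ct : Fin L → Matrix (Fin t) (Fin t) ℂ) (Q₀ : Matrix (Fin t) (Fin t) ℂ)
    (Q : ℕ → Matrix (Fin t) (Fin t) ℂ) (δ δt : ℕ → Fin L → ℝ) : Prop where
  init : Q 0 = Q₀
  canonical : ∀ k, IsCanonicalSolution σ C Ct (Q k) (δ (k + 1)) (δt (k + 1))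
  waterfill : ∀ k, IsWaterfillingSolution Ct (δ (k + 1)) (Q (k + 1))

end MIMO

end

/-!
The argument rests on the potential
`V(κ, κ̃, Q) = log |1 + ∑ κ̃_l C_l| + log |1 + Q ∑ κ_l C̃_l| - σ² t ∑ κ_l κ̃_l`,
whose critical points in `(κ, κ̃)` are the solutions of the canonical system and for which
`Ī(Q) = V(δ(Q), δ̃(Q), Q)`.

*Canonical system.* Both right-hand sides are positive, decreasing and strictly subhomogeneous
(`IsDecreasingInterference`), so their composition is a standard interference function: a fixed
point exists by monotonicity and is unique by comparing two of them at the coordinate of largest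
ratio. Uniqueness and compactness make `δ` and `δ̃` continuous on `C1`
(`IsCanonicalSolution.tendsto`).

*Saddle property.* If `(κ, κ̃)` solves the system for `Q` and `(κ', κ̃')` the one for another
matrix, then `Ī(Q) = V(κ, κ̃, Q) ≤ V(κ', κ κ̃ / κ', Q) ≤ V(κ', κ̃', Q)`. For the first inequality the
bilinear term does not change and both log-determinants are convex functions of `log κ`
(`logDet_one_add_comb_ge`); the second one is concavity in `κ̃` at a critical point. In other words
`Ī(Q) = min_κ max_κ̃ V(κ, κ̃, Q)`, a minimum of concave functions of `Q`.

*Maximizers.* In `V(κ', κ̃', ·)` only the waterfilling objective depends on the matrix. Hence, the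
waterfilling objective being strictly concave, a matrix that solves the waterfilling problem for its
own `δ` is the only possible maximizer of `Ī` (`IsWaterfillingSolution.eq_of_isMaxOn_Ibar`).
Conversely, a maximizer exists by compactness, and comparing it with nearby matrices on segments
shows that it is such a fixed point
(`isWaterfillingSolution_of_isMaxOn_Ibar`).

*Convergence.* If `Q_k → P` and `Q_{k+1} → P'` along an ultrafilter, the hypothesis on
`δ^{(k+1)} - δ^{(k)}` gives `δ(P) = δ(P')`, and `P'` solves the waterfilling problem for `δ(P)`.
So `P'` is a fixed point, that is, the maximizer of `Ī`; compactness of `C1` concludes.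
-/

namespace MIMO

open Matrix

variable {L r t n : ℕ}

/-! ### Positive matrices and their traces -/

theorem comb_posSemidef {A : Fin L → Matrix (Fin n) (Fin n) ℂ} (hA : ∀ l, (A l).PosSemidef)
    {κ : Fin L → ℝ} (hκ : 0 ≤ κ) : (comb A κ).PosSemidef :=
  posSemidef_sum _ fun l _ => (hA l).smul (by exact_mod_cast hκ l)

theorem one_add_comb_posDef {A : Fin L → Matrix (Fin n) (Fin n) ℂ}
    (hA : ∀ l, (A l).PosSemidef) {κ : Fin L → ℝ} (hκ : 0 ≤ κ) : (1 + comb A κ).PosDef :=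
  PosDef.one.add_posSemidef (comb_posSemidef hA hκ)

theorem comb_posDef (hL : 0 < L) {A : Fin L → Matrix (Fin n) (Fin n) ℂ}
    (hA : ∀ l, (A l).PosDef) {κ : Fin L → ℝ} (hκ : ∀ l, 0 < κ l) : (comb A κ).PosDef := by
  have : Nonempty (Fin L) := ⟨⟨0, hL⟩⟩
  exact posDef_sum Finset.univ_nonempty fun l _ => (hA l).smul (by exact_mod_cast hκ l)

theorem comb_add (A : Fin L → Matrix (Fin n) (Fin n) ℂ) (κ μ : Fin L → ℝ) :
    comb A (κ + μ) = comb A κ + comb A μ := by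
  simp [comb, add_smul, Finset.sum_add_distrib]

theorem comb_smul (A : Fin L → Matrix (Fin n) (Fin n) ℂ) (a : ℝ) (κ : Fin L → ℝ) :
    comb A (a • κ) = (a : ℂ) • comb A κ := by
  simp [comb, Finset.smul_sum, mul_smul]

theorem msqrt_mul_self {Q : Matrix (Fin n) (Fin n) ℂ} (hQ : Q.PosSemidef) :
    msqrt Q * msqrt Q = Q :=
  CFC.sqrt_mul_sqrt_self Q (nonneg_iff_posSemidef.2 hQ)

theorem msqrt_posSemidef (Q : Matrix (Fin n) (Fin n) ℂ) : (msqrt Q).PosSemidef :=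
  nonneg_iff_posSemidef.1 (CFC.sqrt_nonneg Q)

theorem trace_mul_re_nonneg {A B : Matrix (Fin n) (Fin n) ℂ} (hA : A.PosSemidef)
    (hB : B.PosSemidef) : 0 ≤ (A * B).trace.re := by
  have h := (hA.conjTranspose_mul_mul_same (msqrt B)).trace_nonneg
  rw [(msqrt_posSemidef B).isHermitian, trace_mul_cycle, msqrt_mul_self hB, trace_mul_comm] at h
  exact (Complex.le_def.1 h).1

theorem trace_mul_re_pos {A B : Matrix (Fin n) (Fin n) ℂ} (hA : A.PosSemidef) (hA0 : A ≠ 0)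
    (hB : B.PosDef) : 0 < (A * B).trace.re := by
  have hp := hA.conjTranspose_mul_mul_same (msqrt B)
  have htr : ((msqrt B)ᴴ * A * msqrt B).trace = (A * B).trace := by
    rw [(msqrt_posSemidef B).isHermitian, trace_mul_cycle, msqrt_mul_self hB.posSemidef,
      trace_mul_comm]
  have hne : ((msqrt B)ᴴ * A * msqrt B).trace ≠ 0 := by
    rw [Ne, hp.trace_eq_zero_iff]
    intro h0
    have hu : IsUnit (msqrt B) := by
      have := hB.isUnit
      rw [← msqrt_mul_self hB.posSemidef] at this
      exact isUnit_of_mul_isUnit_left this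
    apply hA0
    have hu' : IsUnit (msqrt B)ᴴ := by rwa [(msqrt_posSemidef B).isHermitian]
    have h1 := (hu.mul_left_eq_zero).1 h0
    exact (hu'.mul_right_eq_zero).1 h1
  have := lt_of_le_of_ne hp.trace_nonneg hne.symm
  rw [htr] at this
  exact (Complex.lt_def.1 this).1

/-- Inversion of positive definite matrices is antitone for the Loewner order: `S⁻¹ - (S + D)⁻¹`
is congruent to `D + D S⁻¹ D`. -/
theorem inv_sub_inv_add {S D : Matrix (Fin n) (Fin n) ℂ} (hS : S.PosDef) (hD : D.PosSemidef) :
    S⁻¹ - (S + D)⁻¹ = (S + D)⁻¹ * (D + D * S⁻¹ * D) * (S + D)⁻¹ := by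
  have h1 : S * S⁻¹ = 1 := mul_nonsing_inv _ ((isUnit_iff_isUnit_det _).1 hS.isUnit)
  have h1' : S⁻¹ * S = 1 := nonsing_inv_mul _ ((isUnit_iff_isUnit_det _).1 hS.isUnit)
  have hu := (isUnit_iff_isUnit_det _).1 (hS.add_posSemidef hD).isUnit
  have h2 : (S + D) * (S + D)⁻¹ = 1 := mul_nonsing_inv _ hu
  have h2' : (S + D)⁻¹ * (S + D) = 1 := nonsing_inv_mul _ hu
  have key : D + D * S⁻¹ * D = (S + D) * S⁻¹ * (S + D) - (S + D) := by
    simp only [add_mul, mul_add, h1, mul_assoc, h1', mul_one, one_mul]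
    abel
  rw [key, mul_sub, sub_mul, h2', one_mul]
  simp only [mul_assoc, h2, mul_one]
  rw [← mul_assoc, h2', one_mul]

theorem inv_sub_inv_add_posSemidef {S D : Matrix (Fin n) (Fin n) ℂ} (hS : S.PosDef)
    (hD : D.PosSemidef) : (S⁻¹ - (S + D)⁻¹).PosSemidef := by
  rw [inv_sub_inv_add hS hD]
  have h := (hD.add (hS.inv.posSemidef.conjTranspose_mul_mul_same D)).conjTranspose_mul_mul_same
    (S + D)⁻¹
  rwa [(hS.add_posSemidef hD).inv.isHermitian, hD.isHermitian] at h

theorem inv_sub_inv_add_posDef {S D : Matrix (Fin n) (Fin n) ℂ} (hS : S.PosDef)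
    (hD : D.PosDef) : (S⁻¹ - (S + D)⁻¹).PosDef := by
  rw [inv_sub_inv_add hS hD.posSemidef]
  have hi := (hS.add_posSemidef hD.posSemidef).inv
  have h := (hi.isUnit.posDef_star_left_conjugate_iff
    (x := D + D * S⁻¹ * D)).2 (hD.add_posSemidef (by
      have := hS.inv.posSemidef.conjTranspose_mul_mul_same D
      rwa [hD.isHermitian] at this))
  rwa [star_eq_conjTranspose, hi.isHermitian] at h

/-! ### Simultaneous diagonalization and the log-determinant -/

theorem _root_.Matrix.PosDef.det_re_pos {S : Matrix (Fin n) (Fin n) ℂ} (hS : S.PosDef) :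
    0 < S.det.re :=
  (Complex.lt_def.1 hS.det_pos).1

theorem _root_.Matrix.PosDef.det_eq_re {S : Matrix (Fin n) (Fin n) ℂ} (hS : S.PosDef) :
    S.det = (S.det.re : ℂ) :=
  Complex.ext (by simp) (by simpa using (Complex.lt_def.1 hS.det_pos).2.symm)

theorem exists_unitary_diagonalization {N : Matrix (Fin n) (Fin n) ℂ} (hN : N.PosDef) :
    ∃ (U : Matrix (Fin n) (Fin n) ℂ) (m : Fin n → ℝ), (∀ i, 0 < m i) ∧ U * Uᴴ = 1 ∧
      Uᴴ * N * U = diagonal (fun i => (m i : ℂ)) := by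
  refine ⟨hN.isHermitian.eigenvectorUnitary.1, hN.isHermitian.eigenvalues, hN.eigenvalues_pos,
    Unitary.coe_mul_star_self hN.isHermitian.eigenvectorUnitary, ?_⟩
  have h := hN.isHermitian.conjStarAlgAut_star_eigenvectorUnitary
  rwa [Unitary.conjStarAlgAut_star_apply] at h

/-- Two positive definite matrices are diagonalized by one congruence, the first to `1`. -/
theorem exists_simultaneous_diagonalization {S Y : Matrix (Fin n) (Fin n) ℂ} (hS : S.PosDef)
    (hY : Y.PosDef) :
    ∃ (X : Matrix (Fin n) (Fin n) ℂ) (m : Fin n → ℝ), (∀ i, 0 < m i) ∧ X * Xᴴ = S⁻¹ ∧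
      Xᴴ * S * X = 1 ∧ Xᴴ * Y * X = diagonal (fun i => (m i : ℂ)) ∧
      logDet Y = logDet S + ∑ i, Real.log (m i) := by
  set R := msqrt S⁻¹ with hR
  have hRR : R * R = S⁻¹ := msqrt_mul_self hS.inv.posSemidef
  have hRH : Rᴴ = R := (msqrt_posSemidef _).isHermitian
  have hRu : IsUnit R := by
    have := hS.inv.isUnit
    rw [← hRR] at this
    exact isUnit_of_mul_isUnit_left this
  have hN : (R * Y * R).PosDef := by
    have := (hRu.posDef_star_left_conjugate_iff (x := Y)).2 hY
    rwa [star_eq_conjTranspose, hRH] at this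
  obtain ⟨U, m, hm, hUU, hUN⟩ := exists_unitary_diagonalization hN
  have hXX : (R * U) * (R * U)ᴴ = S⁻¹ := by
    rw [conjTranspose_mul, hRH, mul_assoc, ← mul_assoc U, hUU, one_mul, hRR]
  have hS1 : S⁻¹ * S = 1 := nonsing_inv_mul _ ((isUnit_iff_isUnit_det _).1 hS.isUnit)
  have hdiag : (R * U)ᴴ * Y * (R * U) = diagonal (fun i => (m i : ℂ)) := by
    rw [← hUN, conjTranspose_mul, hRH]
    simp only [mul_assoc]
  refine ⟨R * U, m, hm, hXX, ?_, hdiag, ?_⟩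
  · have : (R * U) * ((R * U)ᴴ * S) = 1 := by rw [← mul_assoc, hXX, hS1]
    exact mul_eq_one_comm.1 this
  · have h1 := congrArg det hdiag
    have h2 := congrArg det hXX
    rw [det_diagonal, det_mul, det_mul] at h1
    rw [det_mul, det_nonsing_inv, Ring.inverse_eq_inv'] at h2
    have h3 : Y.det = S.det * ∏ i, (m i : ℂ) := by
      have : S.det ≠ 0 := hS.det_pos.ne'
      rw [← h1]
      calc Y.det = S.det * (S.det)⁻¹ * Y.det := by rw [mul_inv_cancel₀ this, one_mul]
        _ = _ := by rw [← h2]; ring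
    have h4 : Y.det.re = S.det.re * ∏ i, m i := by
      rw [hY.det_eq_re, hS.det_eq_re] at h3
      exact_mod_cast h3
    rw [logDet, logDet, h4, Real.log_mul hS.det_re_pos.ne'
      (Finset.prod_pos fun i _ => hm i).ne',
      Real.log_prod fun i _ => (hm i).ne']

/-- If `X Xᴴ = S⁻¹` then `Tr (A S⁻¹)` is the sum of the diagonal entries of `Xᴴ A X`. -/
theorem trace_mul_inv_re {S X : Matrix (Fin n) (Fin n) ℂ} (hX : X * Xᴴ = S⁻¹)
    (A : Matrix (Fin n) (Fin n) ℂ) :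
    (A * S⁻¹).trace.re = ∑ i, ((Xᴴ * A * X) i i).re := by
  rw [← hX, ← mul_assoc, trace_mul_comm, ← mul_assoc, trace, Complex.re_sum]
  rfl

/-- The log-determinant lies below its tangents. -/
theorem logDet_le_tangent {S Y : Matrix (Fin n) (Fin n) ℂ} (hS : S.PosDef) (hY : Y.PosDef) :
    logDet Y ≤ logDet S + ((Y - S) * S⁻¹).trace.re := by
  obtain ⟨X, m, hm, hXX, h1, hd, hlog⟩ := exists_simultaneous_diagonalization hS hY
  rw [hlog, trace_mul_inv_re hXX, mul_sub, sub_mul, h1, hd]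
  gcongr with i
  simpa using Real.log_le_sub_one_of_pos (hm i)

/-- The tangents of the log-determinant touch it at one point only: it is strictly concave. -/
theorem eq_of_logDet_eq_tangent {S Y : Matrix (Fin n) (Fin n) ℂ} (hS : S.PosDef)
    (hY : Y.PosDef) (h : logDet S + ((Y - S) * S⁻¹).trace.re ≤ logDet Y) : Y = S := by
  obtain ⟨X, m, hm, hXX, h1, hd, hlog⟩ := exists_simultaneous_diagonalization hS hY
  rw [hlog, trace_mul_inv_re hXX, mul_sub, sub_mul, h1, hd] at h
  have h' : ∑ i, (m i - 1) ≤ ∑ i, Real.log (m i) := by simpa using h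
  have hle : ∀ i ∈ Finset.univ, Real.log (m i) ≤ m i - 1 :=
    fun i _ => Real.log_le_sub_one_of_pos (hm i)
  have heq := (Finset.sum_eq_sum_iff_of_le hle).1 (le_antisymm (Finset.sum_le_sum hle) h')
  have hm1 : ∀ i, m i = 1 := fun i => by
    by_contra hne
    exact (Real.log_lt_sub_one_of_pos (hm i) hne).ne (heq i (Finset.mem_univ i))
  have hXY : Xᴴ * Y * X = Xᴴ * S * X := by
    rw [hd, h1, ← diagonal_one]
    simp [hm1]
  have hu : IsUnit X := by
    have := hS.inv.isUnit
    rw [← hXX] at this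
    exact isUnit_of_mul_isUnit_left this
  have hu' : IsUnit Xᴴ := by
    have := hS.inv.isUnit
    rw [← hXX] at this
    exact isUnit_of_mul_isUnit_right this
  exact hu'.mul_left_cancel (hu.mul_right_cancel hXY)

/-- `Tr [A_l (1 + ∑ κ_j A_j)⁻¹]`, the partial derivative of `log |1 + ∑ κ_j A_j|` in `κ_l`. The
trace is real. -/
noncomputable def resolventTrace (A : Fin L → Matrix (Fin n) (Fin n) ℂ) (l : Fin L)
    (κ : Fin L → ℝ) : ℝ :=
  (A l * (1 + comb A κ)⁻¹).trace.re

theorem comb_mul_inv_trace_re (A : Fin L → Matrix (Fin n) (Fin n) ℂ) (w κ : Fin L → ℝ) :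
    (comb A w * (1 + comb A κ)⁻¹).trace.re = ∑ l, w l * resolventTrace A l κ := by
  rw [comb, Finset.sum_mul, trace_sum, Complex.re_sum]
  simp [resolventTrace]

/-- Concavity of `κ ↦ log |1 + ∑ κ_l A_l|`. -/
theorem logDet_one_add_comb_le {A : Fin L → Matrix (Fin n) (Fin n) ℂ}
    (hA : ∀ l, (A l).PosSemidef) {κ μ : Fin L → ℝ} (hκ : 0 ≤ κ) (hμ : 0 ≤ μ) :
    logDet (1 + comb A μ)
      ≤ logDet (1 + comb A κ) + ∑ l, (μ l - κ l) * resolventTrace A l κ := by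
  refine (logDet_le_tangent (one_add_comb_posDef hA hκ) (one_add_comb_posDef hA hμ)).trans_eq ?_
  have : 1 + comb A μ - (1 + comb A κ) = comb A (μ - κ) := by
    rw [sub_eq_add_neg μ, comb_add, ← neg_one_smul ℝ κ, comb_smul]
    push_cast
    rw [neg_one_smul]
    abel
  rw [this, comb_mul_inv_trace_re]
  rfl

/-- Convexity of `u ↦ log |1 + ∑ exp (u_l) A_l|`, as a tangent inequality written in
`κ_l = exp (u_l)`. After a congruence that diagonalizes `1 + ∑ w_l κ_l A_l` it is Jensen's
inequality for `log` on each diagonal entry. -/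
theorem logDet_one_add_comb_ge {A : Fin L → Matrix (Fin n) (Fin n) ℂ}
    (hA : ∀ l, (A l).PosSemidef) {κ w : Fin L → ℝ} (hκ : 0 ≤ κ) (hw : ∀ l, 0 < w l) :
    logDet (1 + comb A κ) + ∑ l, Real.log (w l) * (κ l * resolventTrace A l κ)
      ≤ logDet (1 + comb A (w * κ)) := by
  have hS := one_add_comb_posDef hA hκ
  have hwκ : 0 ≤ w * κ := fun l => mul_nonneg (hw l).le (hκ l)
  obtain ⟨X, m, hm, hXX, h1, hd, hlog⟩ :=
    exists_simultaneous_diagonalization hS (one_add_comb_posDef hA hwκ)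
  -- the diagonal entries of the transformed matrices are the Jensen weights
  let q : Fin n → ℝ := fun i => ((Xᴴ * X) i i).re
  let p : Fin n → Fin L → ℝ := fun i l => κ l * ((Xᴴ * A l * X) i i).re
  have hq : ∀ i, 0 ≤ q i := fun i =>
    (Complex.le_def.1 (posSemidef_conjTranspose_mul_self X).diag_nonneg).1
  have hp : ∀ i l, 0 ≤ p i l := fun i l => mul_nonneg (hκ l)
    (Complex.le_def.1 ((hA l).conjTranspose_mul_mul_same X).diag_nonneg).1
  have hent : ∀ (μ : Fin L → ℝ) i, ((Xᴴ * (1 + comb A μ) * X) i i).re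
      = q i + ∑ l, μ l * ((Xᴴ * A l * X) i i).re := by
    intro μ i
    simp [q, comb, mul_add, add_mul, Finset.mul_sum, Finset.sum_mul, Matrix.sum_apply]
  have hsum1 : ∀ i, q i + ∑ l, p i l = 1 := fun i => by
    rw [← hent κ i, h1]; simp
  have hsumm : ∀ i, q i + ∑ l, w l * p i l = m i := fun i => by
    have := hent (w * κ) i
    rw [hd] at this
    simp only [diagonal_apply_eq, Complex.ofReal_re, Pi.mul_apply] at this
    rw [this]
    simp only [p, mul_assoc]
  have hjensen : ∀ i, ∑ l, Real.log (w l) * p i l ≤ Real.log (m i) := fun i => by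
    have hl : ∀ l, Real.log (w l) * p i l
        ≤ (w l * p i l) / m i + (Real.log (m i) - 1) * p i l := fun l => by
      have h := Real.log_le_sub_one_of_pos (div_pos (hw l) (hm i))
      rw [Real.log_div (hw l).ne' (hm i).ne'] at h
      calc Real.log (w l) * p i l ≤ (w l / m i + (Real.log (m i) - 1)) * p i l :=
            mul_le_mul_of_nonneg_right (by linarith) (hp i l)
        _ = _ := by ring
    have h0 : 0 ≤ q i / m i + (Real.log (m i) - 1) * q i := by
      have h := Real.one_sub_inv_le_log_of_pos (hm i)
      have := mul_nonneg (sub_nonneg.2 h) (hq i)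
      calc (0 : ℝ) ≤ _ := this
        _ = _ := by ring
    calc ∑ l, Real.log (w l) * p i l
        ≤ ∑ l, ((w l * p i l) / m i + (Real.log (m i) - 1) * p i l) :=
          Finset.sum_le_sum fun l _ => hl l
      _ = (∑ l, w l * p i l) / m i + (Real.log (m i) - 1) * ∑ l, p i l := by
          rw [Finset.sum_add_distrib, Finset.sum_div, Finset.mul_sum]
      _ ≤ (q i + ∑ l, w l * p i l) / m i + (Real.log (m i) - 1) * (q i + ∑ l, p i l) := by
          rw [add_div, mul_add]; linarith
      _ = Real.log (m i) := by
          rw [hsum1, hsumm, div_self (hm i).ne']; ring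
  rw [hlog]
  gcongr
  calc ∑ l, Real.log (w l) * (κ l * resolventTrace A l κ)
      = ∑ l, ∑ i, Real.log (w l) * p i l := by
        refine Finset.sum_congr rfl fun l _ => ?_
        rw [resolventTrace, trace_mul_inv_re hXX, Finset.mul_sum, Finset.mul_sum]
    _ = ∑ i, ∑ l, Real.log (w l) * p i l := Finset.sum_comm
    _ ≤ _ := Finset.sum_le_sum fun i _ => hjensen i

/-! ### The traces of the resolvent as interference functions -/

theorem resolventTrace_pos {A : Fin L → Matrix (Fin n) (Fin n) ℂ} (hA : ∀ l, (A l).PosSemidef)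
    {l : Fin L} (hl : A l ≠ 0) {κ : Fin L → ℝ} (hκ : 0 ≤ κ) : 0 < resolventTrace A l κ :=
  trace_mul_re_pos (hA l) hl (one_add_comb_posDef hA hκ).inv

theorem resolventTrace_anti {A : Fin L → Matrix (Fin n) (Fin n) ℂ}
    (hA : ∀ l, (A l).PosSemidef) (l : Fin L) {κ μ : Fin L → ℝ} (hκ : 0 ≤ κ) (h : κ ≤ μ) :
    resolventTrace A l μ ≤ resolventTrace A l κ := by
  have hD := comb_posSemidef hA (sub_nonneg.2 h)
  have := trace_mul_re_nonneg (hA l)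
    (inv_sub_inv_add_posSemidef (one_add_comb_posDef hA hκ) hD)
  rw [add_assoc, ← comb_add, add_sub_cancel, mul_sub, trace_sub, Complex.sub_re] at this
  exact sub_nonneg.1 this

/-- Strict subhomogeneity: multiplying `κ` by `a > 1` divides the traces by less than `a`, because
`a (1 + a S)⁻¹ = (a⁻¹ + S)⁻¹` is larger than `(1 + S)⁻¹`. -/
theorem resolventTrace_lt_mul {A : Fin L → Matrix (Fin n) (Fin n) ℂ}
    (hA : ∀ l, (A l).PosSemidef) {l : Fin L} (hl : A l ≠ 0) {κ : Fin L → ℝ} (hκ : 0 ≤ κ)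
    {a : ℝ} (ha : 1 < a) :
    resolventTrace A l κ < a * resolventTrace A l (a • κ) := by
  have ha0 : 0 < a := one_pos.trans ha
  have haC : (a : ℂ) ≠ 0 := by exact_mod_cast ha0.ne'
  have hP := one_add_comb_posDef hA (smul_nonneg ha0.le hκ)
  have hS : (((a⁻¹ : ℝ) : ℂ) • (1 + comb A (a • κ))).PosDef :=
    hP.smul (by exact_mod_cast inv_pos.2 ha0)
  have hD : (((1 - a⁻¹ : ℝ) : ℂ) • (1 : Matrix (Fin n) (Fin n) ℂ)).PosDef :=
    PosDef.one.smul (by exact_mod_cast sub_pos.2 (inv_lt_one_of_one_lt₀ ha))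
  have hadd : ((a⁻¹ : ℝ) : ℂ) • (1 + comb A (a • κ)) + ((1 - a⁻¹ : ℝ) : ℂ) • 1
      = 1 + comb A κ := by
    rw [comb_smul, smul_add, smul_smul, ← Complex.ofReal_mul, inv_mul_cancel₀ ha0.ne',
      Complex.ofReal_one, one_smul, add_right_comm, ← add_smul, ← Complex.ofReal_add]
    simp
  have hinv : (((a⁻¹ : ℝ) : ℂ) • (1 + comb A (a • κ)))⁻¹ = (a : ℂ) • (1 + comb A (a • κ))⁻¹ := by
    refine inv_eq_right_inv ?_
    rw [smul_mul_smul_comm, mul_nonsing_inv _ ((isUnit_iff_isUnit_det _).1 hP.isUnit),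
      Complex.ofReal_inv, inv_mul_cancel₀ haC, one_smul]
  have := trace_mul_re_pos (hA l) hl (inv_sub_inv_add_posDef hS hD)
  rw [hadd, hinv, mul_sub, trace_sub, Complex.sub_re, mul_smul_comm, trace_smul, smul_eq_mul,
    Complex.re_ofReal_mul] at this
  exact sub_pos.1 this

/-! ### Fixed points of decreasing interference functions -/

/-- A positive, decreasing and strictly subhomogeneous vector function on the nonnegative orthant.
The composition of two such functions is a standard interference function in the sense of Yates. -/
structure IsDecreasingInterference (F : (Fin L → ℝ) → Fin L → ℝ) : Prop where
  pos : ∀ x, 0 ≤ x → ∀ l, 0 < F x l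
  anti : ∀ x y, 0 ≤ x → x ≤ y → F y ≤ F x
  lt_mul : ∀ x, 0 ≤ x → ∀ a : ℝ, 1 < a → ∀ l, F x l < a * F (a • x) l

theorem IsDecreasingInterference.le_of_fixed {F G : (Fin L → ℝ) → Fin L → ℝ}
    (hF : IsDecreasingInterference F) (hG : IsDecreasingInterference G)
    {x y x' y' : Fin L → ℝ} (hy : 0 ≤ y) (hx' : 0 ≤ x') (hy' : 0 ≤ y')
    (hxF : x = F y) (hyG : y = G x) (hxF' : x' = F y') (hyG' : y' = G x') : x' ≤ x := by
  by_contra hcon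
  obtain ⟨l₀, hl₀⟩ : ∃ l, x l < x' l := by
    by_contra! h
    exact hcon h
  have hx : ∀ l, 0 < x l := fun l => hxF ▸ hF.pos y hy l
  -- compare the two solutions at the coordinate where their ratio is largest
  have : Nonempty (Fin L) := ⟨l₀⟩
  obtain ⟨l, hl⟩ := Finite.exists_max fun l => x' l / x l
  set a := x' l / x l with ha
  have ha1 : 1 < a := ((one_lt_div (hx l₀)).2 hl₀).trans_le (hl l₀)
  have hle : x' ≤ a • x := fun j => (div_le_iff₀ (hx j)).1 (hl j)
  have hyy : y ≤ a • y' := fun j => by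
    have h1 := hG.lt_mul x (fun l => (hx l).le) a ha1 j
    have h2 := hG.anti x' _ hx' hle j
    rw [← hyG] at h1
    rw [← hyG'] at h2
    exact h1.le.trans (mul_le_mul_of_nonneg_left h2 (one_pos.trans ha1).le)
  have h1 := hF.lt_mul y' hy' a ha1 l
  have h2 := hF.anti y _ hy hyy l
  rw [← hxF'] at h1
  rw [← hxF] at h2
  have h3 : a * x l = x' l := div_mul_cancel₀ _ (hx l).ne'
  have h4 := mul_le_mul_of_nonneg_left h2 (one_pos.trans ha1).le
  linarith

/-- The largest fixed point of the increasing map `F ∘ G`, as in the Knaster–Tarski theorem. -/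
theorem IsDecreasingInterference.exists_fixed {F G : (Fin L → ℝ) → Fin L → ℝ}
    (hF : IsDecreasingInterference F) (hG : IsDecreasingInterference G) :
    ∃ x, 0 ≤ x ∧ x = F (G x) := by
  have hG0 : ∀ x, 0 ≤ x → 0 ≤ G x := fun x hx l => (hG.pos x hx l).le
  have hmono : ∀ x y, 0 ≤ x → x ≤ y → F (G x) ≤ F (G y) := fun x y hx hxy =>
    hF.anti _ _ (hG0 y (hx.trans hxy)) (hG.anti x y hx hxy)
  let X : Set (Fin L → ℝ) := {x | 0 ≤ x ∧ x ≤ F (G x)}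
  have h0 : (0 : Fin L → ℝ) ∈ X := ⟨le_rfl, fun l => (hF.pos _ (hG0 0 le_rfl) l).le⟩
  have hb : ∀ x ∈ X, x ≤ F 0 := fun x hx => hx.2.trans (hF.anti 0 _ le_rfl (hG0 x hx.1))
  obtain ⟨u, hu⟩ : ∃ u, IsLUB X u := by
    refine ⟨fun l => sSup (Function.eval l '' X), isLUB_pi.2 fun l => ?_⟩
    refine isLUB_csSup ⟨_, 0, h0, rfl⟩ ⟨F 0 l, ?_⟩
    rintro _ ⟨x, hx, rfl⟩
    exact hb x hx l
  have hu0 : 0 ≤ u := hu.1 h0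
  have hle : u ≤ F (G u) := hu.2 fun x hx => hx.2.trans (hmono x u hx.1 (hu.1 hx))
  exact ⟨u, hu0, le_antisymm hle
    (hu.1 ⟨hu0.trans hle, hmono _ _ hu0 hle⟩)⟩

/-! ### The canonical system -/

/-- The family `Q^{1/2} C̃^{(l)} Q^{1/2}`. -/
noncomputable def sandwich (Q : Matrix (Fin t) (Fin t) ℂ)
    (Ct : Fin L → Matrix (Fin t) (Fin t) ℂ) : Fin L → Matrix (Fin t) (Fin t) ℂ :=
  fun l => msqrt Q * Ct l * msqrt Q

theorem sandwich_posSemidef (Q : Matrix (Fin t) (Fin t) ℂ)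
    {Ct : Fin L → Matrix (Fin t) (Fin t) ℂ} (hCt : ∀ l, (Ct l).PosDef) (l : Fin L) :
    (sandwich Q Ct l).PosSemidef := by
  have := (hCt l).posSemidef.conjTranspose_mul_mul_same (msqrt Q)
  rwa [(msqrt_posSemidef Q).isHermitian] at this

theorem sandwich_ne_zero {Q : Matrix (Fin t) (Fin t) ℂ} (hQ : Q.PosSemidef) (hQ0 : Q ≠ 0)
    {Ct : Fin L → Matrix (Fin t) (Fin t) ℂ} (hCt : ∀ l, (Ct l).PosDef) (l : Fin L) :
    sandwich Q Ct l ≠ 0 := by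
  intro h
  have h1 := trace_mul_re_pos hQ hQ0 (hCt l)
  have h2 : (sandwich Q Ct l).trace = (Q * Ct l).trace := by
    rw [sandwich, trace_mul_cycle, msqrt_mul_self hQ]
  rw [← h2, h] at h1
  simp at h1

theorem comb_sandwich (Q : Matrix (Fin t) (Fin t) ℂ) (Ct : Fin L → Matrix (Fin t) (Fin t) ℂ)
    (κ : Fin L → ℝ) : comb (sandwich Q Ct) κ = msqrt Q * comb Ct κ * msqrt Q := by
  simp [comb, sandwich, Finset.mul_sum, Finset.sum_mul]

theorem det_one_add_mul_comb {Q : Matrix (Fin t) (Fin t) ℂ} (hQ : Q.PosSemidef)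
    (Ct : Fin L → Matrix (Fin t) (Fin t) ℂ) (κ : Fin L → ℝ) :
    (1 + Q * comb Ct κ).det = (1 + comb (sandwich Q Ct) κ).det := by
  rw [comb_sandwich, det_one_add_mul_comm (msqrt Q * comb Ct κ), ← mul_assoc, msqrt_mul_self hQ]

theorem mem_C1_iff (ht : 0 < t) {Q : Matrix (Fin t) (Fin t) ℂ} :
    Q ∈ C1 t ↔ Q.PosSemidef ∧ Q.trace = t := by
  have : (t : ℂ) ≠ 0 := by exact_mod_cast ht.ne'
  refine and_congr_right fun _ => ?_
  rw [one_div, inv_mul_eq_iff_eq_mul₀ this, mul_one]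

theorem ne_zero_of_mem_C1 {Q : Matrix (Fin t) (Fin t) ℂ} (hQ : Q ∈ C1 t) : Q ≠ 0 := by
  rintro rfl
  simpa using hQ.2

theorem f_eq_resolventTrace (t : ℕ) {σ : ℝ} (hσ : 0 < σ)
    {A : Fin L → Matrix (Fin n) (Fin n) ℂ} (hA : ∀ l, (A l).PosSemidef) (l : Fin L)
    {κ : Fin L → ℝ} (hκ : 0 ≤ κ) : f t σ A l κ = (σ ^ 2 * t)⁻¹ * resolventTrace A l κ := by
  have hS := (isUnit_iff_isUnit_det _).1 (one_add_comb_posDef hA hκ).isUnit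
  have hT : T σ A κ = (((σ ^ 2)⁻¹ : ℝ) : ℂ) • (1 + comb A κ)⁻¹ := by
    refine inv_eq_right_inv ?_
    change (((σ ^ 2 : ℝ) : ℂ) • (1 + comb A κ)) * _ = 1
    rw [smul_mul_smul_comm, mul_nonsing_inv _ hS, ← Complex.ofReal_mul,
      mul_inv_cancel₀ (by positivity), Complex.ofReal_one, one_smul]
  rw [f, hT, mul_smul_comm, trace_smul, smul_eq_mul, Complex.re_ofReal_mul, resolventTrace,
    mul_inv]
  ring

theorem ft_eq_f (σ : ℝ) (Ct : Fin L → Matrix (Fin t) (Fin t) ℂ) (l : Fin L) (κ : Fin L → ℝ)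
    (Q : Matrix (Fin t) (Fin t) ℂ) : ft σ Ct l κ Q = f t σ (sandwich Q Ct) l κ :=
  rfl

theorem isDecreasingInterference_f (ht : 0 < t) {σ : ℝ} (hσ : 0 < σ)
    {A : Fin L → Matrix (Fin n) (Fin n) ℂ} (hA : ∀ l, (A l).PosSemidef) (hA0 : ∀ l, A l ≠ 0) :
    IsDecreasingInterference fun x l => f t σ A l x where
  pos x hx l := by
    rw [f_eq_resolventTrace t hσ hA l hx]
    have := resolventTrace_pos hA (hA0 l) hx
    positivity
  anti x y hx hxy l := by
    beta_reduce
    rw [f_eq_resolventTrace t hσ hA l hx, f_eq_resolventTrace t hσ hA l (hx.trans hxy)]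
    exact mul_le_mul_of_nonneg_left (resolventTrace_anti hA l hx hxy) (by positivity)
  lt_mul x hx a ha l := by
    rw [f_eq_resolventTrace t hσ hA l hx,
      f_eq_resolventTrace t hσ hA l (smul_nonneg (one_pos.trans ha).le hx), mul_left_comm]
    exact mul_lt_mul_of_pos_left (resolventTrace_lt_mul hA (hA0 l) hx ha) (by positivity)

section Canonical

variable {σ : ℝ} {C : Fin L → Matrix (Fin r) (Fin r) ℂ} {Ct : Fin L → Matrix (Fin t) (Fin t) ℂ}
  {Q : Matrix (Fin t) (Fin t) ℂ} {κ κt κ' κt' : Fin L → ℝ}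

theorem isDecreasingInterference_receive (hr : 0 < r) (ht : 0 < t) (hσ : 0 < σ)
    (hC : ∀ l, (C l).PosDef) : IsDecreasingInterference fun x l => f t σ C l x := by
  have : Nonempty (Fin r) := ⟨⟨0, hr⟩⟩
  refine isDecreasingInterference_f ht hσ (fun l => (hC l).posSemidef) fun l h => ?_
  simpa [h] using (hC l).trace_pos

theorem isDecreasingInterference_transmit (ht : 0 < t) (hσ : 0 < σ)
    (hCt : ∀ l, (Ct l).PosDef) (hQ : Q ∈ C1 t) :
    IsDecreasingInterference fun x l => ft σ Ct l x Q :=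
  isDecreasingInterference_f ht hσ (sandwich_posSemidef Q hCt)
    (sandwich_ne_zero hQ.1 (ne_zero_of_mem_C1 hQ) hCt)

/-- Nonnegative solutions of the canonical system are positive. -/
theorem IsCanonicalSolution.of_nonneg (hr : 0 < r) (ht : 0 < t) (hσ : 0 < σ)
    (hC : ∀ l, (C l).PosDef) (hCt : ∀ l, (Ct l).PosDef) (hQ : Q ∈ C1 t) (hκ : 0 ≤ κ)
    (hκt : 0 ≤ κt) (h : ∀ l, κ l = f t σ C l κt) (ht' : ∀ l, κt l = ft σ Ct l κ Q) :
    IsCanonicalSolution σ C Ct Q κ κt where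
  pos l := h l ▸ (isDecreasingInterference_receive hr ht hσ hC).pos _ hκt l
  pos_tilde l := ht' l ▸ (isDecreasingInterference_transmit ht hσ hCt hQ).pos _ hκ l
  eq := h
  eq_tilde := ht'

theorem IsCanonicalSolution.unique (hr : 0 < r) (ht : 0 < t) (hσ : 0 < σ)
    (hC : ∀ l, (C l).PosDef) (hCt : ∀ l, (Ct l).PosDef) (hQ : Q ∈ C1 t)
    (h : IsCanonicalSolution σ C Ct Q κ κt) (h' : IsCanonicalSolution σ C Ct Q κ' κt') :
    κ = κ' ∧ κt = κt' := by
  have hF := isDecreasingInterference_receive hr ht hσ hC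
  have hG := isDecreasingInterference_transmit ht hσ hCt hQ
  have e : κ = κ' := le_antisymm
    (hF.le_of_fixed hG (fun l => (h'.pos_tilde l).le) (fun l => (h.pos l).le)
      (fun l => (h.pos_tilde l).le) (funext h'.eq) (funext h'.eq_tilde) (funext h.eq)
      (funext h.eq_tilde))
    (hF.le_of_fixed hG (fun l => (h.pos_tilde l).le) (fun l => (h'.pos l).le)
      (fun l => (h'.pos_tilde l).le) (funext h.eq) (funext h.eq_tilde) (funext h'.eq)
      (funext h'.eq_tilde))
  subst e
  exact ⟨rfl, funext fun l => (h.eq_tilde l).trans (h'.eq_tilde l).symm⟩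

theorem exists_isCanonicalSolution (hr : 0 < r) (ht : 0 < t) (hσ : 0 < σ)
    (hC : ∀ l, (C l).PosDef) (hCt : ∀ l, (Ct l).PosDef) (hQ : Q ∈ C1 t) :
    ∃ κ κt, IsCanonicalSolution σ C Ct Q κ κt := by
  have hG := isDecreasingInterference_transmit ht hσ hCt hQ
  obtain ⟨x, hx, hfix⟩ := (isDecreasingInterference_receive hr ht hσ hC).exists_fixed hG
  exact ⟨x, _, .of_nonneg hr ht hσ hC hCt hQ hx (fun l => (hG.pos x hx l).le)
    (fun l => congrFun hfix l) fun _ => rfl⟩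

theorem isCanonicalSolution_delta (hr : 0 < r) (ht : 0 < t) (hσ : 0 < σ)
    (hC : ∀ l, (C l).PosDef) (hCt : ∀ l, (Ct l).PosDef) (hQ : Q ∈ C1 t) :
    IsCanonicalSolution σ C Ct Q (delta σ C Ct Q) (deltat σ C Ct Q) := by
  have h : ∃ p : (Fin L → ℝ) × (Fin L → ℝ), IsCanonicalSolution σ C Ct Q p.1 p.2 := by
    obtain ⟨κ, κt, h⟩ := exists_isCanonicalSolution hr ht hσ hC hCt hQ
    exact ⟨(κ, κt), h⟩
  rw [delta, deltat, canonicalSolution, dif_pos h]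
  exact h.choose_spec

theorem IsCanonicalSolution.resolventTrace_eq (ht : 0 < t) (hσ : 0 < σ)
    (hC : ∀ l, (C l).PosDef) (h : IsCanonicalSolution σ C Ct Q κ κt) (l : Fin L) :
    resolventTrace C l κt = σ ^ 2 * t * κ l := by
  rw [h.eq l, f_eq_resolventTrace t hσ (fun l => (hC l).posSemidef) l
    (fun l => (h.pos_tilde l).le), mul_inv_cancel_left₀ (by positivity)]

theorem IsCanonicalSolution.resolventTrace_sandwich_eq (ht : 0 < t) (hσ : 0 < σ)
    (hCt : ∀ l, (Ct l).PosDef) (h : IsCanonicalSolution σ C Ct Q κ κt) (l : Fin L) :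
    resolventTrace (sandwich Q Ct) l κ = σ ^ 2 * t * κt l := by
  rw [h.eq_tilde l, ft_eq_f, f_eq_resolventTrace t hσ (sandwich_posSemidef Q hCt) l
    (fun l => (h.pos l).le), mul_inv_cancel_left₀ (by positivity)]

/-! ### The potential and its saddle property -/

/-- The function of `(κ, κ̃, Q)` whose critical points in `(κ, κ̃)` are the solutions of the
canonical system and whose critical value is `Ī(Q)`. -/
noncomputable def potential (σ : ℝ) (C : Fin L → Matrix (Fin r) (Fin r) ℂ)
    (Ct : Fin L → Matrix (Fin t) (Fin t) ℂ) (κ κt : Fin L → ℝ) (Q : Matrix (Fin t) (Fin t) ℂ) :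
    ℝ :=
  logDet (1 + comb C κt) + logDet (1 + Q * comb Ct κ) - σ ^ 2 * t * ∑ l, κ l * κt l

theorem Ibar_eq_potential (σ : ℝ) (C : Fin L → Matrix (Fin r) (Fin r) ℂ)
    (Ct : Fin L → Matrix (Fin t) (Fin t) ℂ) (Q : Matrix (Fin t) (Fin t) ℂ) :
    Ibar σ C Ct Q = potential σ C Ct (delta σ C Ct Q) (deltat σ C Ct Q) Q :=
  rfl

/-- Along the curve on which every product `κ_l κ̃_l` is constant, the potential is convex in
`log κ`, so that its critical point is a minimum there. -/
theorem IsCanonicalSolution.potential_le_of_mul_eq (ht : 0 < t) (hσ : 0 < σ)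
    (hC : ∀ l, (C l).PosDef) (hCt : ∀ l, (Ct l).PosDef) (hQ : Q ∈ C1 t)
    (h : IsCanonicalSolution σ C Ct Q κ κt) {w : Fin L → ℝ} (hw : ∀ l, 0 < w l) :
    potential σ C Ct κ κt Q ≤ potential σ C Ct (w * κ) (w⁻¹ * κt) Q := by
  have h1 := logDet_one_add_comb_ge (sandwich_posSemidef Q hCt) (fun l => (h.pos l).le) hw
  have h2 := logDet_one_add_comb_ge (fun l => (hC l).posSemidef)
    (fun l => (h.pos_tilde l).le) (w := w⁻¹) (fun l => inv_pos.2 (hw l))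
  have e1 : ∑ l, Real.log (w⁻¹ l) * (κt l * resolventTrace C l κt)
      = -∑ l, Real.log (w l) * (κ l * resolventTrace (sandwich Q Ct) l κ) := by
    rw [← Finset.sum_neg_distrib]
    refine Finset.sum_congr rfl fun l _ => ?_
    rw [h.resolventTrace_eq ht hσ hC, h.resolventTrace_sandwich_eq ht hσ hCt, Pi.inv_apply,
      Real.log_inv]
    ring
  have e2 : ∑ l, (w * κ) l * (w⁻¹ * κt) l = ∑ l, κ l * κt l := by
    refine Finset.sum_congr rfl fun l _ => ?_
    have := (hw l).ne'
    simp only [Pi.mul_apply, Pi.inv_apply]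
    field_simp
  have hd : ∀ μ : Fin L → ℝ, logDet (1 + Q * comb Ct μ) = logDet (1 + comb (sandwich Q Ct) μ) :=
    fun μ => by rw [logDet, logDet, det_one_add_mul_comb hQ.1]
  rw [potential, potential, hd, hd, e2]
  rw [e1] at h2
  linarith

/-- A critical point of the potential is a maximum in `κ̃`. -/
theorem IsCanonicalSolution.potential_le_of_nonneg (ht : 0 < t) (hσ : 0 < σ)
    (hC : ∀ l, (C l).PosDef) (h : IsCanonicalSolution σ C Ct Q κ κt) {μ : Fin L → ℝ}
    (hμ : 0 ≤ μ) (P : Matrix (Fin t) (Fin t) ℂ) :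
    potential σ C Ct κ μ P ≤ potential σ C Ct κ κt P := by
  have h1 := logDet_one_add_comb_le (fun l => (hC l).posSemidef)
    (fun l => (h.pos_tilde l).le) hμ
  have e : ∑ l, (μ l - κt l) * resolventTrace C l κt
      = σ ^ 2 * t * ∑ l, κ l * μ l - σ ^ 2 * t * ∑ l, κ l * κt l := by
    rw [Finset.mul_sum, Finset.mul_sum, ← Finset.sum_sub_distrib]
    refine Finset.sum_congr rfl fun l _ => ?_
    rw [h.resolventTrace_eq ht hσ hC]
    ring
  rw [e] at h1
  rw [potential, potential]
  linarith

/-- `Ī(Q) = min_κ max_κ̃ V(κ, κ̃, Q)` for the potential `V`, tested at the value of `κ` that belongs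
to another matrix `P`. -/
theorem IsCanonicalSolution.potential_le (ht : 0 < t) (hσ : 0 < σ)
    (hC : ∀ l, (C l).PosDef) (hCt : ∀ l, (Ct l).PosDef) (hQ : Q ∈ C1 t)
    {P : Matrix (Fin t) (Fin t) ℂ} (h : IsCanonicalSolution σ C Ct Q κ κt)
    (h' : IsCanonicalSolution σ C Ct P κ' κt') :
    potential σ C Ct κ κt Q ≤ potential σ C Ct κ' κt' Q := by
  have hw : ∀ l, 0 < (κ' / κ) l := fun l => div_pos (h'.pos l) (h.pos l)
  have e : κ' / κ * κ = κ' := funext fun l => div_mul_cancel₀ _ (h.pos l).ne'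
  have h1 := h.potential_le_of_mul_eq ht hσ hC hCt hQ hw
  rw [e] at h1
  exact h1.trans (h'.potential_le_of_nonneg ht hσ hC
    (fun l => mul_nonneg (inv_pos.2 (hw l)).le (h.pos_tilde l).le) Q)

end Canonical

/-! ### Continuity of the solution of the canonical system -/

theorem tendsto_inv_matrix {α : Type*} {F : Filter α} {M : α → Matrix (Fin n) (Fin n) ℂ}
    {N : Matrix (Fin n) (Fin n) ℂ} (hM : Tendsto M F (𝓝 N)) (hN : N.det ≠ 0) :
    Tendsto (fun a => (M a)⁻¹) F (𝓝 N⁻¹) := by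
  have hc : ContinuousAt Ring.inverse N.det := by
    simpa [Ring.inverse_eq_inv'] using continuousAt_inv₀ hN
  exact (continuousAt_matrix_inv N hc).tendsto.comp hM

theorem continuous_comb (A : Fin L → Matrix (Fin n) (Fin n) ℂ) : Continuous (comb A) := by
  unfold comb
  fun_prop

theorem tendsto_logDet {α : Type*} {F : Filter α} {M : α → Matrix (Fin n) (Fin n) ℂ}
    {N : Matrix (Fin n) (Fin n) ℂ} (hM : Tendsto M F (𝓝 N)) (hN : N.det.re ≠ 0) :
    Tendsto (fun a => logDet (M a)) F (𝓝 (logDet N)) :=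
  (((Complex.continuous_re.comp continuous_id.matrix_det).tendsto N).comp hM).log hN

/-- The square roots of `Q` are absorbed by the push-through identity
`Q^{1/2} (1 + Q^{1/2} M Q^{1/2})⁻¹ = (1 + Q M)⁻¹ Q^{1/2}`. -/
theorem resolventTrace_sandwich {Q : Matrix (Fin t) (Fin t) ℂ} (hQ : Q.PosSemidef)
    {Ct : Fin L → Matrix (Fin t) (Fin t) ℂ} (hCt : ∀ l, (Ct l).PosDef) (l : Fin L)
    {κ : Fin L → ℝ} (hκ : 0 ≤ κ) :
    resolventTrace (sandwich Q Ct) l κ = (Ct l * ((1 + Q * comb Ct κ)⁻¹ * Q)).trace.re := by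
  have hS := one_add_comb_posDef (sandwich_posSemidef Q hCt) hκ
  have h1 := mul_nonsing_inv _ ((isUnit_iff_isUnit_det _).1 hS.isUnit)
  have h2 : (1 + Q * comb Ct κ)⁻¹ * (1 + Q * comb Ct κ) = 1 := by
    refine nonsing_inv_mul _ ?_
    rw [det_one_add_mul_comb hQ]
    exact (isUnit_iff_isUnit_det _).1 hS.isUnit
  have h3 : (1 + Q * comb Ct κ) * msqrt Q = msqrt Q * (1 + comb (sandwich Q Ct) κ) := by
    nth_rewrite 1 [← msqrt_mul_self hQ]
    rw [comb_sandwich, add_mul, mul_add, one_mul, mul_one]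
    simp only [mul_assoc]
  have h4 : msqrt Q * (1 + comb (sandwich Q Ct) κ)⁻¹ = (1 + Q * comb Ct κ)⁻¹ * msqrt Q := by
    calc msqrt Q * (1 + comb (sandwich Q Ct) κ)⁻¹
        = (1 + Q * comb Ct κ)⁻¹ * ((1 + Q * comb Ct κ) * msqrt Q)
          * (1 + comb (sandwich Q Ct) κ)⁻¹ := by rw [← mul_assoc, h2, one_mul]
      _ = _ := by rw [h3, mul_assoc, mul_assoc (msqrt Q), h1, mul_one]
  have h5 : sandwich Q Ct l * (1 + comb (sandwich Q Ct) κ)⁻¹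
      = msqrt Q * (Ct l * ((1 + Q * comb Ct κ)⁻¹ * msqrt Q)) := by
    rw [← h4, sandwich]
    simp only [mul_assoc]
  rw [resolventTrace, h5, trace_mul_comm, mul_assoc, mul_assoc, msqrt_mul_self hQ]

theorem one_add_mul_comb_det_re_pos {Q : Matrix (Fin t) (Fin t) ℂ} (hQ : Q.PosSemidef)
    {Ct : Fin L → Matrix (Fin t) (Fin t) ℂ} (hCt : ∀ l, (Ct l).PosDef) {κ : Fin L → ℝ}
    (hκ : 0 ≤ κ) : 0 < (1 + Q * comb Ct κ).det.re := by
  rw [det_one_add_mul_comb hQ]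
  exact (one_add_comb_posDef (sandwich_posSemidef Q hCt) hκ).det_re_pos

section Limits

variable {σ : ℝ} {C : Fin L → Matrix (Fin r) (Fin r) ℂ} {Ct : Fin L → Matrix (Fin t) (Fin t) ℂ}
  {Q : Matrix (Fin t) (Fin t) ℂ} {κ κt : Fin L → ℝ} {α : Type*} {F : Filter α}
  {Qs : α → Matrix (Fin t) (Fin t) ℂ} {κs κts : α → Fin L → ℝ}

theorem tendsto_one_add_mul_comb (hQs : Tendsto Qs F (𝓝 Q)) (hκs : Tendsto κs F (𝓝 κ)) :
    Tendsto (fun a => 1 + Qs a * comb Ct (κs a)) F (𝓝 (1 + Q * comb Ct κ)) :=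
  tendsto_const_nhds.add (hQs.mul (((continuous_comb Ct).tendsto κ).comp hκs))

theorem tendsto_f (hσ : 0 < σ) (hC : ∀ l, (C l).PosDef) (l : Fin L) (hκts0 : ∀ a, 0 ≤ κts a)
    (hκt0 : 0 ≤ κt) (hκts : Tendsto κts F (𝓝 κt)) :
    Tendsto (fun a => f t σ C l (κts a)) F (𝓝 (f t σ C l κt)) := by
  have hC' := fun l => (hC l).posSemidef
  simp only [f_eq_resolventTrace t hσ hC' l (hκts0 _), f_eq_resolventTrace t hσ hC' l hκt0]
  have h1 : Tendsto (fun a => 1 + comb C (κts a)) F (𝓝 (1 + comb C κt)) :=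
    tendsto_const_nhds.add (((continuous_comb C).tendsto κt).comp hκts)
  have h2 := (tendsto_const_nhds (x := C l)).mul
    (tendsto_inv_matrix h1 (one_add_comb_posDef hC' hκt0).det_pos.ne')
  exact tendsto_const_nhds.mul
    (((Complex.continuous_re.comp continuous_id.matrix_trace).tendsto _).comp h2)

theorem tendsto_ft (hσ : 0 < σ) (hCt : ∀ l, (Ct l).PosDef) (l : Fin L)
    (hQs0 : ∀ a, (Qs a).PosSemidef) (hQ : Q.PosSemidef) (hκs0 : ∀ a, 0 ≤ κs a) (hκ0 : 0 ≤ κ)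
    (hQs : Tendsto Qs F (𝓝 Q)) (hκs : Tendsto κs F (𝓝 κ)) :
    Tendsto (fun a => ft σ Ct l (κs a) (Qs a)) F (𝓝 (ft σ Ct l κ Q)) := by
  simp only [ft_eq_f, f_eq_resolventTrace t hσ (sandwich_posSemidef _ hCt) l (hκs0 _),
    f_eq_resolventTrace t hσ (sandwich_posSemidef Q hCt) l hκ0,
    resolventTrace_sandwich (hQs0 _) hCt l (hκs0 _), resolventTrace_sandwich hQ hCt l hκ0]
  have hdet : (1 + Q * comb Ct κ).det ≠ 0 := fun h => by
    have := one_add_mul_comb_det_re_pos hQ hCt hκ0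
    simp [h] at this
  have h2 := (tendsto_const_nhds (x := Ct l)).mul
    ((tendsto_inv_matrix (tendsto_one_add_mul_comb hQs hκs) hdet).mul hQs)
  exact tendsto_const_nhds.mul
    (((Complex.continuous_re.comp continuous_id.matrix_trace).tendsto _).comp h2)

theorem tendsto_logDet_one_add_mul_comb (hCt : ∀ l, (Ct l).PosDef) (hQ : Q.PosSemidef)
    (hκ : 0 ≤ κ) (hQs : Tendsto Qs F (𝓝 Q)) (hκs : Tendsto κs F (𝓝 κ)) :
    Tendsto (fun a => logDet (1 + Qs a * comb Ct (κs a))) F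
      (𝓝 (logDet (1 + Q * comb Ct κ))) :=
  tendsto_logDet (tendsto_one_add_mul_comb hQs hκs) (one_add_mul_comb_det_re_pos hQ hCt hκ).ne'

theorem tendsto_potential (hC : ∀ l, (C l).PosDef) (hCt : ∀ l, (Ct l).PosDef)
    (hQ : Q.PosSemidef) (hκ : 0 ≤ κ) (hκt : 0 ≤ κt) (hQs : Tendsto Qs F (𝓝 Q))
    (hκs : Tendsto κs F (𝓝 κ)) (hκts : Tendsto κts F (𝓝 κt)) :
    Tendsto (fun a => potential σ C Ct (κs a) (κts a) (Qs a)) F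
      (𝓝 (potential σ C Ct κ κt Q)) := by
  have h1 : Tendsto (fun a => logDet (1 + comb C (κts a))) F (𝓝 (logDet (1 + comb C κt))) :=
    tendsto_logDet (tendsto_const_nhds.add (((continuous_comb C).tendsto κt).comp hκts))
      (one_add_comb_posDef (fun l => (hC l).posSemidef) hκt).det_re_pos.ne'
  refine (h1.add (tendsto_logDet_one_add_mul_comb hCt hQ hκ hQs hκs)).sub
    (tendsto_const_nhds.mul (tendsto_finsetSum _ fun l _ => ?_))
  exact (tendsto_pi_nhds.1 hκs l).mul (tendsto_pi_nhds.1 hκts l)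

/-- The solution of the canonical system depends continuously on `Q`: solutions stay in a compact
box, and a cluster point is a solution for the limit matrix, of which there is only one. -/
theorem IsCanonicalSolution.tendsto (hr : 0 < r) (ht : 0 < t) (hσ : 0 < σ)
    (hC : ∀ l, (C l).PosDef) (hCt : ∀ l, (Ct l).PosDef) (hQsC : ∀ a, Qs a ∈ C1 t)
    (hQC : Q ∈ C1 t) (hQs : Tendsto Qs F (𝓝 Q))
    (hs : ∀ a, IsCanonicalSolution σ C Ct (Qs a) (κs a) (κts a))
    (h : IsCanonicalSolution σ C Ct Q κ κt) :
    Tendsto κs F (𝓝 κ) ∧ Tendsto κts F (𝓝 κt) := by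
  suffices hp : Tendsto (fun a => (κs a, κts a)) F (𝓝 (κ, κt)) from
    ⟨(continuous_fst.tendsto _).comp hp, (continuous_snd.tendsto _).comp hp⟩
  refine (tendsto_iff_ultrafilter _ _ _).2 fun U hU => ?_
  have hQU := hQs.mono_left hU
  have hκs0 : ∀ a, 0 ≤ κs a := fun a l => ((hs a).pos l).le
  have hκts0 : ∀ a, 0 ≤ κts a := fun a l => ((hs a).pos_tilde l).le
  -- the box is given by the values of the right-hand sides at `0`, up to a margin for `Qs a ≠ Q`
  let b : (Fin L → ℝ) × (Fin L → ℝ) :=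
    (fun l => f t σ C l 0, fun l => ft σ Ct l 0 Q + 1)
  have hbox : ∀ᶠ a in (U : Filter α), (κs a, κts a) ∈ Set.Icc 0 b := by
    have h1 : ∀ᶠ a in (U : Filter α), ∀ l, ft σ Ct l 0 (Qs a) < ft σ Ct l 0 Q + 1 :=
      eventually_all.2 fun l =>
        (tendsto_ft hσ hCt l (fun a => (hQsC a).1) hQC.1 (fun _ => le_rfl) le_rfl hQU
          (tendsto_const_nhds (x := (0 : Fin L → ℝ)))).eventually_lt_const (lt_add_one _)
    filter_upwards [h1] with a ha
    refine ⟨⟨hκs0 a, hκts0 a⟩, fun l => ?_, fun l => ?_⟩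
    · change κs a l ≤ _
      rw [(hs a).eq l]
      exact (isDecreasingInterference_receive hr ht hσ hC).anti 0 _ le_rfl (hκts0 a) l
    · change κts a l ≤ _
      rw [(hs a).eq_tilde l]
      exact ((isDecreasingInterference_transmit ht hσ hCt (hQsC a)).anti 0 _ le_rfl
        (hκs0 a) l).trans (ha l).le
  obtain ⟨⟨x, y⟩, hxy, hlim⟩ :=
    isCompact_Icc.ultrafilter_le_nhds (U.map fun a => (κs a, κts a)) (le_principal_iff.2 hbox)
  have hlim' : Tendsto (fun a => (κs a, κts a)) U (𝓝 (x, y)) := hlim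
  have hx : Tendsto κs U (𝓝 x) := (continuous_fst.tendsto _).comp hlim'
  have hy : Tendsto κts U (𝓝 y) := (continuous_snd.tendsto _).comp hlim'
  have hsol : IsCanonicalSolution σ C Ct Q x y := by
    refine .of_nonneg hr ht hσ hC hCt hQC hxy.1.1 hxy.1.2 (fun l => ?_) fun l => ?_
    · refine tendsto_nhds_unique (tendsto_pi_nhds.1 hx l) ?_
      simp only [fun a => (hs a).eq l]
      exact tendsto_f hσ hC l hκts0 hxy.1.2 hy
    · refine tendsto_nhds_unique (tendsto_pi_nhds.1 hy l) ?_
      simp only [fun a => (hs a).eq_tilde l]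
      exact tendsto_ft hσ hCt l (fun a => (hQsC a).1) hQC.1 hκs0 hxy.1.1 hQU hx
  obtain ⟨rfl, rfl⟩ := hsol.unique hr ht hσ hC hCt hQC h
  exact hlim'

end Limits

/-! ### The constraint set and the waterfilling problem -/

theorem convex_C1 (ht : 0 < t) : Convex ℝ (C1 t) := by
  intro P hP Q hQ a b ha hb hab
  rw [mem_C1_iff ht] at *
  refine ⟨(hP.1.smul ha).add (hQ.1.smul hb), ?_⟩
  rw [trace_add, trace_smul, trace_smul, hP.2, hQ.2, ← add_smul, hab, one_smul]

theorem one_mem_C1 (ht : 0 < t) : (1 : Matrix (Fin t) (Fin t) ℂ) ∈ C1 t :=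
  (mem_C1_iff ht).2 ⟨PosSemidef.one, by simp⟩

/-- The set `C1` is the image of a sphere under `B ↦ Bᴴ B`. -/
theorem isCompact_C1 (ht : 0 < t) : IsCompact (C1 t) := by
  let K : Set (Matrix (Fin t) (Fin t) ℂ) := {B | (Bᴴ * B).trace = t}
  have hcont : Continuous fun B : Matrix (Fin t) (Fin t) ℂ => Bᴴ * B :=
    continuous_id.matrix_conjTranspose.mul continuous_id
  have hK : IsCompact K := by
    refine IsCompact.of_isClosed_subset
      (isCompact_univ_pi fun _ => isCompact_univ_pi fun _ =>
        isCompact_closedBall (0 : ℂ) (Real.sqrt t))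
      (isClosed_eq hcont.matrix_trace continuous_const) fun B hB i _ j _ => ?_
    have h1 : ∑ j, ∑ i, ‖B i j‖ ^ 2 = (t : ℝ) := by
      have h : (Bᴴ * B).trace = t := hB
      simp only [trace, diag_apply, mul_apply, conjTranspose_apply, RCLike.star_def,
        Complex.conj_mul'] at h
      exact_mod_cast h
    rw [mem_closedBall_zero_iff]
    refine Real.le_sqrt_of_sq_le ?_
    rw [← h1]
    exact (Finset.single_le_sum (f := fun i => ‖B i j‖ ^ 2) (fun i _ => by positivity)
      (Finset.mem_univ i)).trans (Finset.single_le_sum (f := fun j => ∑ i, ‖B i j‖ ^ 2)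
        (fun j _ => by positivity) (Finset.mem_univ j))
  have himg : C1 t = (fun B => Bᴴ * B) '' K := by
    ext Q
    rw [mem_C1_iff ht]
    constructor
    · rintro ⟨h1, h2⟩
      have h3 : (msqrt Q)ᴴ * msqrt Q = Q := by
        rw [(msqrt_posSemidef Q).isHermitian, msqrt_mul_self h1]
      exact ⟨msqrt Q, by rw [Set.mem_ofPred_eq, h3, h2], h3⟩
    · rintro ⟨B, hB, rfl⟩
      exact ⟨posSemidef_conjTranspose_mul_self B, hB⟩
  rw [himg]
  exact hK.image hcont

theorem strictConcaveOn_logDet :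
    StrictConcaveOn ℝ {S : Matrix (Fin n) (Fin n) ℂ | S.PosDef} logDet := by
  have hconv : Convex ℝ {S : Matrix (Fin n) (Fin n) ℂ | S.PosDef} :=
    convex_iff_forall_pos.2 fun P hP Q hQ a b ha hb _ => (hP.smul ha).add (hQ.smul hb)
  refine ⟨hconv, fun P hP Q hQ hne a b ha hb hab => ?_⟩
  set S := a • P + b • Q with hSdef
  have hS : S.PosDef := hconv hP hQ ha.le hb.le hab
  have h1 := logDet_le_tangent hS hP
  have h2 := logDet_le_tangent hS hQ
  have h0 : a * ((P - S) * S⁻¹).trace.re + b * ((Q - S) * S⁻¹).trace.re = 0 := by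
    have h3 : a • ((P - S) * S⁻¹) + b • ((Q - S) * S⁻¹) = 0 := by
      rw [← smul_mul_assoc, ← smul_mul_assoc, ← add_mul, smul_sub, smul_sub,
        sub_add_sub_comm, ← add_smul, hab, one_smul, ← hSdef, sub_self, zero_mul]
    have h4 := congrArg (fun M : Matrix (Fin n) (Fin n) ℂ => M.trace.re) h3
    simpa using h4
  by_contra hcon
  have hcon' : logDet S ≤ a * logDet P + b * logDet Q := not_lt.1 hcon
  have e : logDet S = a * logDet S + b * logDet S := by rw [← add_mul, hab, one_mul]
  have hP' : logDet S + ((P - S) * S⁻¹).trace.re ≤ logDet P := by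
    have := mul_le_mul_of_nonneg_left h2 hb.le
    refine le_of_mul_le_mul_left ?_ ha
    linarith
  have hQ' : logDet S + ((Q - S) * S⁻¹).trace.re ≤ logDet Q := by
    have := mul_le_mul_of_nonneg_left h1 ha.le
    refine le_of_mul_le_mul_left ?_ hb
    linarith
  exact hne ((eq_of_logDet_eq_tangent hS hP hP').trans (eq_of_logDet_eq_tangent hS hQ hQ').symm)

theorem strictConcaveOn_logDet_one_add_mul (ht : 0 < t) {M : Matrix (Fin t) (Fin t) ℂ}
    (hM : M.PosDef) : StrictConcaveOn ℝ (C1 t) fun Q => logDet (1 + Q * M) := by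
  have hu : IsUnit (msqrt M) := by
    have := hM.isUnit
    rw [← msqrt_mul_self hM.posSemidef] at this
    exact isUnit_of_mul_isUnit_left this
  have hdet : ∀ Q, logDet (1 + Q * M) = logDet (1 + msqrt M * Q * msqrt M) := fun Q => by
    nth_rewrite 1 [← msqrt_mul_self hM.posSemidef]
    rw [logDet, logDet, ← mul_assoc, det_one_add_mul_comm, mul_assoc]
  have hpd : ∀ Q ∈ C1 t, (1 + msqrt M * Q * msqrt M).PosDef := fun Q hQ => by
    have := hQ.1.conjTranspose_mul_mul_same (msqrt M)
    rw [(msqrt_posSemidef M).isHermitian] at this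
    exact PosDef.one.add_posSemidef this
  refine ⟨convex_C1 ht, fun P hP Q hQ hne a b ha hb hab => ?_⟩
  have hne' : 1 + msqrt M * P * msqrt M ≠ 1 + msqrt M * Q * msqrt M := fun h =>
    hne (hu.mul_left_cancel (hu.mul_right_cancel (add_left_cancel h)))
  have h := strictConcaveOn_logDet.2 (hpd P hP) (hpd Q hQ) hne' ha hb hab
  have e : a • (1 + msqrt M * P * msqrt M) + b • (1 + msqrt M * Q * msqrt M)
      = 1 + msqrt M * (a • P + b • Q) * msqrt M := by
    rw [smul_add, smul_add, add_add_add_comm, ← add_smul, hab, one_smul, mul_add, add_mul]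
    simp
  rw [e] at h
  simpa only [hdet] using h

section Waterfilling

variable {Ct : Fin L → Matrix (Fin t) (Fin t) ℂ} {κ : Fin L → ℝ}

theorem IsWaterfillingSolution.unique (hL : 0 < L) (ht : 0 < t) (hCt : ∀ l, (Ct l).PosDef)
    (hκ : ∀ l, 0 < κ l) {P P' : Matrix (Fin t) (Fin t) ℂ} (h : IsWaterfillingSolution Ct κ P)
    (h' : IsWaterfillingSolution Ct κ P') : P = P' :=
  (strictConcaveOn_logDet_one_add_mul ht (comb_posDef hL hCt hκ)).eq_of_isMaxOn h.2 h'.2 h.1 h'.1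

theorem exists_isWaterfillingSolution (ht : 0 < t) (hCt : ∀ l, (Ct l).PosDef)
    (hκ : ∀ l, 0 < κ l) : ∃ P, IsWaterfillingSolution Ct κ P :=
  (isCompact_C1 ht).exists_isMaxOn ⟨1, one_mem_C1 ht⟩ fun _ hQ =>
    tendsto_logDet_one_add_mul_comb hCt hQ.1 (fun l => (hκ l).le)
      (tendsto_id.mono_left nhdsWithin_le_nhds) tendsto_const_nhds

end Waterfilling

/-! ### Maximizers of the large system approximation -/

section Maximizers

variable {σ : ℝ} {C : Fin L → Matrix (Fin r) (Fin r) ℂ} {Ct : Fin L → Matrix (Fin t) (Fin t) ℂ}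

/-- Moving `Q` in the potential only changes the waterfilling objective. -/
theorem potential_le_potential_iff {κ κt : Fin L → ℝ} {P Q : Matrix (Fin t) (Fin t) ℂ} :
    potential σ C Ct κ κt P ≤ potential σ C Ct κ κt Q ↔
      logDet (1 + P * comb Ct κ) ≤ logDet (1 + Q * comb Ct κ) := by
  simp [potential]

/-- A fixed point `Q` of the waterfilling iteration is the only possible maximizer of `Ī`: since
`V(δ(Q), δ̃(Q), P)` is an upper bound of `Ī(P)` for the potential `V`, and is attained at `P = Q`, a
maximizer of `Ī` also solves the waterfilling problem for `δ(Q)`. -/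
theorem IsWaterfillingSolution.eq_of_isMaxOn_Ibar (hL : 0 < L) (hr : 0 < r) (ht : 0 < t)
    (hσ : 0 < σ) (hC : ∀ l, (C l).PosDef) (hCt : ∀ l, (Ct l).PosDef)
    {P Q : Matrix (Fin t) (Fin t) ℂ} (h : IsWaterfillingSolution Ct (delta σ C Ct Q) Q)
    (hP : P ∈ C1 t) (hmax : IsMaxOn (Ibar σ C Ct) (C1 t) P) : P = Q := by
  have hδ := isCanonicalSolution_delta hr ht hσ hC hCt h.1
  have h1 : potential σ C Ct (delta σ C Ct Q) (deltat σ C Ct Q) Q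
      ≤ potential σ C Ct (delta σ C Ct Q) (deltat σ C Ct Q) P :=
    (hmax h.1).trans ((isCanonicalSolution_delta hr ht hσ hC hCt hP).potential_le ht hσ hC hCt
      hP hδ)
  have h2 := potential_le_potential_iff.1 h1
  exact IsWaterfillingSolution.unique hL ht hCt hδ.pos ⟨hP, fun R hR => (h.2 hR).trans h2⟩ h

theorem continuousOn_Ibar (hr : 0 < r) (ht : 0 < t) (hσ : 0 < σ) (hC : ∀ l, (C l).PosDef)
    (hCt : ∀ l, (Ct l).PosDef) : ContinuousOn (Ibar σ C Ct) (C1 t) := by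
  rw [continuousOn_iff_continuous_domRestrict, continuous_iff_continuousAt]
  intro Q
  have hδ := fun P : C1 t => isCanonicalSolution_delta hr ht hσ hC hCt P.2
  have hlim : Tendsto (fun P : C1 t => (P : Matrix (Fin t) (Fin t) ℂ)) (𝓝 Q) (𝓝 Q) :=
    continuous_subtype_val.tendsto Q
  obtain ⟨h1, h2⟩ :=
    IsCanonicalSolution.tendsto hr ht hσ hC hCt (fun P => P.2) Q.2 hlim hδ (hδ Q)
  exact tendsto_potential hC hCt Q.2.1 (fun l => ((hδ Q).pos l).le)
    (fun l => ((hδ Q).pos_tilde l).le) hlim h1 h2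

/-- A maximizer of `Ī` is a fixed point of the waterfilling iteration. On the segment from the
maximizer `Q` to `P`, with `Q_s = (1 - s) Q + s P`, concavity of the potential in its last argument
and the saddle property give
`Ī(Q) ≥ Ī(Q_s) ≥ (1 - s) Ī(Q) + s V(δ(Q_s), δ̃(Q_s), P)`; divide by `s` and let `s → 0`. -/
theorem isWaterfillingSolution_of_isMaxOn_Ibar (hL : 0 < L) (hr : 0 < r) (ht : 0 < t)
    (hσ : 0 < σ) (hC : ∀ l, (C l).PosDef) (hCt : ∀ l, (Ct l).PosDef)
    {Q : Matrix (Fin t) (Fin t) ℂ} (hQ : Q ∈ C1 t) (hmax : IsMaxOn (Ibar σ C Ct) (C1 t) Q) :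
    IsWaterfillingSolution Ct (delta σ C Ct Q) Q := by
  refine ⟨hQ, fun P hP => ?_⟩
  let s : ℕ → ℝ := fun k => 1 / ((k : ℝ) + 1)
  have hs0 : ∀ k, 0 < s k := fun k => Nat.one_div_pos_of_nat
  have hs1 : ∀ k, 0 ≤ 1 - s k := fun k => by
    rw [sub_nonneg, div_le_one (by positivity)]
    exact le_add_of_nonneg_left (Nat.cast_nonneg k)
  let R : ℕ → Matrix (Fin t) (Fin t) ℂ := fun k => (1 - s k) • Q + s k • P
  have hR : ∀ k, R k ∈ C1 t := fun k =>
    convex_C1 ht hQ hP (hs1 k) (hs0 k).le (sub_add_cancel _ _)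
  have hRlim : Tendsto R atTop (𝓝 Q) := by
    have h := tendsto_one_div_add_atTop_nhds_zero_nat (𝕜 := ℝ)
    have h' := ((tendsto_const_nhds (x := (1 : ℝ)).sub h).smul_const Q).add (h.smul_const P)
    rwa [sub_zero, one_smul, zero_smul, add_zero] at h'
  have hδ := fun k => isCanonicalSolution_delta hr ht hσ hC hCt (hR k)
  have hδQ := isCanonicalSolution_delta hr ht hσ hC hCt hQ
  obtain ⟨h1, h2⟩ := IsCanonicalSolution.tendsto hr ht hσ hC hCt hR hQ hRlim hδ hδQ
  have hlim := tendsto_potential (σ := σ) hC hCt hP.1 (fun l => (hδQ.pos l).le)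
    (fun l => (hδQ.pos_tilde l).le) (tendsto_const_nhds (x := P)) h1 h2
  refine potential_le_potential_iff.1 (le_of_tendsto hlim (Eventually.of_forall fun k => ?_))
  have hconc := (strictConcaveOn_logDet_one_add_mul ht
    (comb_posDef hL hCt (hδ k).pos)).concaveOn.2 hQ hP (hs1 k) (hs0 k).le (sub_add_cancel _ _)
  have hsad := hδQ.potential_le ht hσ hC hCt hQ (hδ k)
  have hle : Ibar σ C Ct (R k) ≤ Ibar σ C Ct Q := hmax (hR k)
  rw [Ibar_eq_potential, Ibar_eq_potential] at hle
  have hpot : (1 - s k) * potential σ C Ct (delta σ C Ct (R k)) (deltat σ C Ct (R k)) Q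
      + s k * potential σ C Ct (delta σ C Ct (R k)) (deltat σ C Ct (R k)) P
      ≤ potential σ C Ct (delta σ C Ct (R k)) (deltat σ C Ct (R k)) (R k) := by
    simp only [smul_eq_mul] at hconc
    simp only [potential]
    refine le_of_eq_of_le ?_ (sub_le_sub_right (add_le_add_right hconc
      (logDet (1 + comb C (deltat σ C Ct (R k))))) _)
    ring
  have hsad' := mul_le_mul_of_nonneg_left hsad (hs1 k)
  refine le_of_mul_le_mul_left ?_ (hs0 k)
  linarith

end Maximizers

/-! ### Convergence of the iteration -/

/-- Limit points of the iteration are waterfilling fixed points: along an ultrafilter `Q_k` and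
`Q_{k+1}` tend to matrices with the same `δ`, and the second one solves the waterfilling problem
for the `δ` of the first. -/
theorem IsIterativeWaterfilling.tendsto (hL : 0 < L) (hr : 0 < r) (ht : 0 < t) {σ : ℝ}
    (hσ : 0 < σ) {C : Fin L → Matrix (Fin r) (Fin r) ℂ} (hC : ∀ l, (C l).PosDef)
    {Ct : Fin L → Matrix (Fin t) (Fin t) ℂ} (hCt : ∀ l, (Ct l).PosDef)
    {Qstar Q₀ : Matrix (Fin t) (Fin t) ℂ} (hstar : Qstar ∈ C1 t)
    (hmax : IsMaxOn (Ibar σ C Ct) (C1 t) Qstar) (hQ₀ : Q₀ ∈ C1 t)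
    {Q : ℕ → Matrix (Fin t) (Fin t) ℂ} {δ δt : ℕ → Fin L → ℝ}
    (h : IsIterativeWaterfilling σ C Ct Q₀ Q δ δt)
    (hδ : Tendsto (fun k => δ (k + 2) - δ (k + 1)) atTop (𝓝 0)) :
    Tendsto Q atTop (𝓝 Qstar) := by
  have hQ : ∀ k, Q k ∈ C1 t := fun k => by
    cases k with
    | zero => exact h.init ▸ hQ₀
    | succ k => exact (h.waterfill k).1
  rw [← tendsto_add_atTop_iff_nat 1]
  refine (tendsto_iff_ultrafilter _ _ _).2 fun U hU => ?_
  have hclust : ∀ j : ℕ, ∃ P ∈ C1 t, Tendsto (fun k => Q (k + j)) U (𝓝 P) := fun j =>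
    (isCompact_C1 ht).ultrafilter_le_nhds (U.map fun k => Q (k + j))
      (tendsto_principal.2 (Eventually.of_forall fun k => hQ (k + j)))
  obtain ⟨P, hP, hPlim⟩ := hclust 0
  obtain ⟨P', hP', hPlim'⟩ := hclust 1
  have hs := isCanonicalSolution_delta hr ht hσ hC hCt hP
  have hs' := isCanonicalSolution_delta hr ht hσ hC hCt hP'
  have h1 := (IsCanonicalSolution.tendsto hr ht hσ hC hCt (fun k => hQ k) hP hPlim
    (fun k => h.canonical k) hs).1
  have h2 := (IsCanonicalSolution.tendsto hr ht hσ hC hCt (fun k => hQ (k + 1)) hP' hPlim'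
    (fun k => h.canonical (k + 1)) hs').1
  have heq : delta σ C Ct P' = delta σ C Ct P :=
    sub_eq_zero.1 (tendsto_nhds_unique (h2.sub h1) (hδ.mono_left hU))
  have hfix : IsWaterfillingSolution Ct (delta σ C Ct P') P' := by
    refine ⟨hP', fun R hR => ?_⟩
    rw [heq]
    have hpos : 0 ≤ delta σ C Ct P := fun l => (hs.pos l).le
    exact le_of_tendsto_of_tendsto'
      (tendsto_logDet_one_add_mul_comb hCt hR.1 hpos tendsto_const_nhds h1)
      (tendsto_logDet_one_add_mul_comb hCt hP'.1 hpos hPlim' h1)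
      fun k => (h.waterfill k).2 hR
  rw [hfix.eq_of_isMaxOn_Ibar hL hr ht hσ hC hCt hstar hmax]
  exact hPlim'

end MIMO

theorem proposition2 {L r t : ℕ} (hL : 0 < L) (hr : 0 < r) (ht : 0 < t)
    (σ : ℝ) (hσ : 0 < σ)
    (C : Fin L → Matrix (Fin r) (Fin r) ℂ) (hC : ∀ l, (C l).PosDef)
    (Ct : Fin L → Matrix (Fin t) (Fin t) ℂ) (hCt : ∀ l, (Ct l).PosDef) :
    -- the canonical system and the waterfilling problem are well posed
    (∀ Q ∈ MIMO.C1 t, ∃! p : (Fin L → ℝ) × (Fin L → ℝ),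
      MIMO.IsCanonicalSolution σ C Ct Q p.1 p.2) ∧
    (∀ κ : Fin L → ℝ, (∀ l, 0 < κ l) → ∃! P, MIMO.IsWaterfillingSolution Ct κ P) ∧
    -- there is a unique maximizer, and the algorithm converges to it
    ∃ Qstar ∈ MIMO.C1 t,
      IsMaxOn (MIMO.Ibar σ C Ct) (MIMO.C1 t) Qstar ∧
      (∀ P ∈ MIMO.C1 t, IsMaxOn (MIMO.Ibar σ C Ct) (MIMO.C1 t) P → P = Qstar) ∧
      ∀ Q₀ ∈ MIMO.C1 t,
      ∀ (Q : ℕ → Matrix (Fin t) (Fin t) ℂ) (δ δt : ℕ → Fin L → ℝ),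
        MIMO.IsIterativeWaterfilling σ C Ct Q₀ Q δ δt →
        Tendsto (fun k => δ (k + 2) - δ (k + 1)) atTop (𝓝 0) →
        Tendsto (fun k => δt (k + 2) - δt (k + 1)) atTop (𝓝 0) →
        Tendsto Q atTop (𝓝 Qstar) := by
  refine ⟨fun Q hQ => ?_, fun κ hκ => ?_, ?_⟩
  · obtain ⟨κ, κt, h⟩ := MIMO.exists_isCanonicalSolution hr ht hσ hC hCt hQ
    refine ⟨(κ, κt), h, fun p hp => ?_⟩
    obtain ⟨h1, h2⟩ := MIMO.IsCanonicalSolution.unique hr ht hσ hC hCt hQ hp h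
    exact Prod.ext h1 h2
  · obtain ⟨P, hP⟩ := MIMO.exists_isWaterfillingSolution ht hCt hκ
    exact ⟨P, hP, fun P' hP' => MIMO.IsWaterfillingSolution.unique hL ht hCt hκ hP' hP⟩
  · obtain ⟨Qstar, hstar, hmax⟩ := (MIMO.isCompact_C1 ht).exists_isMaxOn
      ⟨1, MIMO.one_mem_C1 ht⟩ (MIMO.continuousOn_Ibar (σ := σ) hr ht hσ hC hCt)
    have hfix := MIMO.isWaterfillingSolution_of_isMaxOn_Ibar hL hr ht hσ hC hCt hstar hmax
    exact ⟨Qstar, hstar, hmax,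
      fun P hP hPmax => hfix.eq_of_isMaxOn_Ibar hL hr ht hσ hC hCt hP hPmax,
      fun Q₀ hQ₀ Q δ δt h hδ _ =>
        h.tendsto hL hr ht hσ hC hCt hstar hmax hQ₀ hδ⟩
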